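/- For a finite simple graph $G$ on $n$ vertices, let $A(G)$ be its adjacency matrix, $D(G)$ the diagonal matrix of its vertex degrees, and $Q(G)=A(G)+D(G)$ its signless Laplacian matrix. After fixing an ordering of the vertices, the $Q$-walk matrix of $G$ is the $n\times n$ matrix $$W_Q(G)=[e,\,Q(G)e,\,\ldots,\,Q(G)^{n-1}e],$$ where $e$ is the all-one vector (a different ordering of the vertices only permutes the rows, so it changes $\det W_Q(G)$ at most by a sign). Let $P_m$ be the path on $m$ vertices, and let $G\circ P_m$ be the rooted product, that is, the graph on $nm$ vertices obtained from $G$ and $n$ copies of $P_m$ by identifying, for each $i=1,\ldots,n$, the $i$-th vertex of $G$ with an endvertex (the root) of the $i$-th copy of $P_m$. Theorem. For any finite simple graph $G$ and any integer $m\ge 2$, $$\det W_Q(G\circ P_m)=\pm\,(\det Q(G))^{m-1}(\det W_Q(G))^m,$$ that is, the left-hand side equals the product on the right-hand side or its negative. -/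

import Mathlib

/-- The rooted product of `G` with the graph `H` rooted at `r`. The pair `(v, w)` is the vertex `w`
in the copy of `H` attached at `v`; in particular `(v, r)`, the root of that copy, is the vertex `v`
of `G`. -/
def SimpleGraph.rootedProduct {V W : Type*} (G : SimpleGraph V) (H : SimpleGraph W) (r : W) :
    SimpleGraph (V × W) where
  Adj x y := (x.1 = y.1 ∧ H.Adj x.2 y.2) ∨ (x.2 = r ∧ y.2 = r ∧ G.Adj x.1 y.1)
  symm := ⟨by
    rintro x y (⟨h, h'⟩ | ⟨h, h', h''⟩)
    · exact Or.inl ⟨h.symm, h'.symm⟩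
    · exact Or.inr ⟨h', h, h''.symm⟩⟩
  loopless := ⟨by
    rintro x (⟨_, h⟩ | ⟨_, _, h⟩)
    · exact H.loopless.irrefl _ h
    · exact G.loopless.irrefl _ h⟩

open Classical in
/-- The signless Laplacian matrix `Q(G) = A(G) + D(G)`. -/
noncomputable def SimpleGraph.signlessLapMatrix {V : Type*} [Fintype V] (G : SimpleGraph V) :
    Matrix V V ℝ :=
  G.adjMatrix ℝ + G.degMatrix ℝ

open Classical in
/-- The `Q`-walk matrix `[e, Q e, …, Q ^ (n - 1) e]` of a graph `G` on `n` vertices, where the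
bijection `σ` lists the vertices of `G` as `σ 0, …, σ (n - 1)` and `e` is the all-one vector.
The rows are ordered according to `σ`. -/
noncomputable def SimpleGraph.qWalkMatrix {V : Type*} [Fintype V] (G : SimpleGraph V) {n : ℕ}
    (σ : Fin n ≃ V) : Matrix (Fin n) (Fin n) ℝ :=
  Matrix.of fun i j => ((G.signlessLapMatrix ^ (j : ℕ)).mulVec (fun _ => (1 : ℝ))) (σ i)

/-! Number each path so that its root comes last. Then `Q(G ∘ P_m)` is the block matrix obtained
from `N = weightedPath m` over `ℤ[X]` by substituting `M = Q(G)` for `X`. Determinants of such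
blocks are computed first over `ℤ[X]`, then at `M` (`det_blockHom`), and signs are removed by
squaring.

With `q = pathPoly (m - 1)` and `χ = pathCharPoly (m - 1)`, the first basis vector `e₀` satisfies
`pathPoly j (N) e₀ = e_j` for `j < m`, and `χ(N) = X • q(N)`. Coprimality of `χ` and `q` makes
`q(N)` invertible.

The all-one vector is `pathSum m (N) e₀`, so its walk matrix is the one from `e₀` multiplied by
`pathSum m (N)`, whose determinant is `±X ^ (m - 1)` (`associated_det_aeval_pathSum`). This produces
`det Q(G) ^ (m - 1)`.

For the walk from `e₀`, the powers of `X` are replaced by the basis `χ ^ i * q ^ (n - 1 - i) *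
pathPoly j`, which sends `e₀` to `q(N) ^ (n - 1) X ^ i e_j`. Up to a factor of determinant `±1`, the
result is `m` diagonal copies of the walk matrix of `M` (`blockWalkMatrix_mul_pathBasisMatrix`),
whence `det W_Q(G) ^ m`. -/

open Polynomial Matrix
open scoped Kronecker

/-! ### Polynomials attached to a path -/

/-- The Chebyshev-like polynomials with `U 0 = 0`, `U 1 = 1`, `U (k + 2) = (X - 2) U (k + 1) - U k`. -/
noncomputable def pathU : ℕ → ℤ[X]
  | 0 => 0
  | 1 => 1
  | k + 2 => (X - 2) * pathU (k + 1) - pathU k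

/-- The polynomials `q k` which carry an end vertex of a path to the vertex at distance `k` when
they are evaluated at the signless Laplacian of the path. -/
noncomputable def pathPoly (k : ℕ) : ℤ[X] := pathU (k + 1) + pathU k

/-- The characteristic polynomial of the signless Laplacian of the path on `k + 1` vertices. -/
noncomputable def pathCharPoly (k : ℕ) : ℤ[X] := pathPoly (k + 1) + pathPoly k

lemma pathU_add_two (k : ℕ) : pathU (k + 2) = (X - 2) * pathU (k + 1) - pathU k := rfl

lemma pathPoly_zero : pathPoly 0 = 1 := by simp [pathPoly, pathU]

lemma pathPoly_one : pathPoly 1 = X - 1 := by simp [pathPoly, pathU]; ring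

lemma pathPoly_add_two (k : ℕ) :
    pathPoly (k + 2) = (X - 2) * pathPoly (k + 1) - pathPoly k := by
  simp only [pathPoly, pathU_add_two]; ring

lemma pathCharPoly_eq (k : ℕ) : pathCharPoly k = X * pathU (k + 1) := by
  simp only [pathCharPoly, pathPoly, pathU_add_two]; ring

lemma natDegree_pathU_le (k : ℕ) : (pathU k).natDegree ≤ k - 1 := by
  induction k using Nat.twoStepInduction with
  | zero => simp [pathU]
  | one => simp [pathU]
  | more k ih₁ ih₂ =>
    rw [pathU_add_two]
    refine (natDegree_sub_le_of_le (natDegree_mul_le_of_le (m := 1) ?_ ih₂) ih₁).trans (by omega)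
    compute_degree

lemma natDegree_pathPoly_le (k : ℕ) : (pathPoly k).natDegree ≤ k :=
  (natDegree_add_le_of_le (natDegree_pathU_le _) (natDegree_pathU_le _)).trans (by omega)

lemma natDegree_pathCharPoly_le (k : ℕ) : (pathCharPoly k).natDegree ≤ k + 1 :=
  (natDegree_add_le_of_le (natDegree_pathPoly_le _) (natDegree_pathPoly_le _)).trans (by omega)

/-- The recurrence is a Euclidean algorithm: `pathPoly (k + 2)` is `-pathPoly k` modulo `pathPoly (k
+ 1)`, down to `pathPoly 0 = 1`. -/
lemma isCoprime_pathCharPoly (k : ℕ) : IsCoprime (pathCharPoly k) (pathPoly k) := by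
  have h : ∀ k, IsCoprime (pathPoly (k + 1)) (pathPoly k) := by
    intro k
    induction k with
    | zero => rw [pathPoly_zero]; exact isCoprime_one_right
    | succ k ih =>
      have := (IsCoprime.neg_left ih.symm).add_mul_right_left (X - 2)
      rwa [show -pathPoly k + (X - 2) * pathPoly (k + 1) = pathPoly (k + 2) by
        rw [pathPoly_add_two]; ring] at this
  have := (h k).add_mul_right_left 1
  rwa [one_mul] at this

/-- The sum of the polynomials `pathPoly`, which carries an end vertex of a path to the all-one
vector. -/
noncomputable def pathSum (m : ℕ) : ℤ[X] := ∑ k ∈ Finset.range m, pathPoly k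

lemma natDegree_pathSum_le (k : ℕ) : (pathSum (k + 1)).natDegree ≤ k :=
  natDegree_sum_le_of_forall_le _ _ fun i hi =>
    (natDegree_pathPoly_le i).trans (by simp at hi; omega)

lemma pathU_pell (k : ℕ) :
    pathU (k + 1) ^ 2 + pathU k ^ 2 - (X - 2) * pathU k * pathU (k + 1) = 1 := by
  induction k with
  | zero => simp [pathU]
  | succ k ih => rw [pathU_add_two]; linear_combination ih

lemma mul_pathSum (m : ℕ) :
    (X - 4) * pathSum m = 2 * pathU (m + 1) - (X - 2) * pathU m - 2 := by
  induction m with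
  | zero => simp [pathSum, pathU]
  | succ m ih =>
    rw [pathSum, Finset.sum_range_succ, mul_add, ← pathSum, ih, pathPoly, pathU_add_two]; ring

/-- The cofactor of `pathSum` in the square of `pathCharPoly`. -/
noncomputable def pathCofactor (m : ℕ) : ℤ[X] :=
  X * (2 + (2 * pathU (m + 1) - (X - 2) * pathU m))

lemma natDegree_pathCofactor_le (k : ℕ) : (pathCofactor (k + 1)).natDegree ≤ k + 2 := by
  have h₁ := natDegree_pathU_le (k + 1)
  have h₂ := natDegree_pathU_le (k + 2)
  have h₃ : ((2 : ℤ[X]) * pathU (k + 2)).natDegree ≤ 0 + (k + 1) :=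
    natDegree_mul_le_of_le (by compute_degree) h₂
  have h₄ : (((X : ℤ[X]) - 2) * pathU (k + 1)).natDegree ≤ 1 + k :=
    natDegree_mul_le_of_le (by compute_degree) h₁
  have h₅ : (2 + (2 * pathU (k + 2) - (X - 2) * pathU (k + 1))).natDegree ≤ k + 1 :=
    (natDegree_add_le_of_le (natDegree_ofNat 2).le (natDegree_sub_le_of_le h₃ h₄)).trans
      (by omega)
  exact (natDegree_mul_le_of_le natDegree_X_le h₅).trans (by omega)

/-- Put `T = 2 * pathU (k + 2) - (X - 2) * pathU (k + 1)`. After multiplication by `X - 4` the left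
side is `X * (T ^ 2 - 4)`, and `pathU_pell` gives `T ^ 2 - 4 = X * (X - 4) * pathU (k + 1) ^ 2`. -/
lemma pathSum_mul_pathCofactor (k : ℕ) :
    pathSum (k + 1) * pathCofactor (k + 1) = pathCharPoly k ^ 2 := by
  have h4 : (X - 4 : ℤ[X]) ≠ 0 := X_sub_C_ne_zero (4 : ℤ)
  apply mul_left_cancel₀ h4
  rw [← mul_assoc, mul_pathSum, pathCofactor, pathCharPoly_eq]
  linear_combination 4 * X * pathU_pell (k + 1)

/-! ### Determinants of polynomials in the weighted path matrix -/

lemma natDegree_det_le_sum {R ι : Type*} [CommRing R] [Fintype ι] [DecidableEq ι]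
    {A : Matrix ι ι R[X]} {d : ι → ℕ} (h : ∀ i j, (A i j).natDegree ≤ d i) :
    A.det.natDegree ≤ ∑ i, d i := by
  rw [det_apply]
  refine natDegree_sum_le_of_forall_le _ _ fun τ _ => ?_
  refine (natDegree_smul_le _ _).trans ((natDegree_prod_le _ _).trans ?_)
  rw [← Equiv.sum_comp τ d]
  exact Finset.sum_le_sum fun i _ => h _ _

/-- The signless Laplacian of the path on `m` vertices, with the variable `X` added at the entry of
the last vertex. -/
noncomputable def weightedPath (m : ℕ) : Matrix (Fin m) (Fin m) ℤ[X] :=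
  Matrix.of fun a b =>
    (if (a : ℕ) + 1 = b ∨ (b : ℕ) + 1 = a then 1 else 0) +
      if a = b then
        (if 0 < (a : ℕ) then 1 else 0) + (if (a : ℕ) + 1 < m then 1 else 0) +
          (if (a : ℕ) + 1 = m then X else 0)
      else 0

section

variable {k : ℕ}

lemma weightedPath_mulVec_zero :
    weightedPath (k + 2) *ᵥ Pi.single 0 1 = Pi.single 0 1 + Pi.single 1 1 := by
  change weightedPath (k + 2) *ᵥ Pi.single ⟨0, by omega⟩ 1 =
    Pi.single ⟨0, by omega⟩ 1 + Pi.single ⟨1, by omega⟩ 1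
  ext1 a
  simp only [mulVec_single_one, col_apply, weightedPath, of_apply, Pi.add_apply, Pi.single_apply,
    Fin.ext_iff]
  split_ifs <;> first | omega | (simp; done) | grind

lemma weightedPath_mulVec_of_lt (j : ℕ) (hj : j + 2 < k + 2) :
    weightedPath (k + 2) *ᵥ Pi.single ⟨j + 1, by omega⟩ 1 =
      Pi.single ⟨j, by omega⟩ 1 + 2 • Pi.single ⟨j + 1, by omega⟩ 1 + Pi.single ⟨j + 2, hj⟩ 1 := by
  ext1 a
  simp only [mulVec_single_one, col_apply, weightedPath, of_apply, Pi.add_apply, Pi.single_apply,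
    Pi.smul_apply, Fin.ext_iff]
  split_ifs <;> first | omega | norm_num

lemma weightedPath_mulVec_last :
    weightedPath (k + 2) *ᵥ Pi.single ⟨k + 1, by omega⟩ 1 =
      Pi.single ⟨k, by omega⟩ 1 + (1 + X : ℤ[X]) • Pi.single ⟨k + 1, by omega⟩ 1 := by
  ext1 a
  simp only [mulVec_single_one, col_apply, weightedPath, of_apply, Pi.add_apply, Pi.single_apply,
    Pi.smul_apply, Fin.ext_iff]
  split_ifs <;> first | omega | simp

lemma aeval_weightedPath_mulVec_recurrence (j : ℕ) (v : Fin (k + 2) → ℤ[X]) :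
    aeval (weightedPath (k + 2)) (pathPoly (j + 2)) *ᵥ v =
      weightedPath (k + 2) *ᵥ (aeval (weightedPath (k + 2)) (pathPoly (j + 1)) *ᵥ v) -
        2 • (aeval (weightedPath (k + 2)) (pathPoly (j + 1)) *ᵥ v) -
        aeval (weightedPath (k + 2)) (pathPoly j) *ᵥ v := by
  simp only [pathPoly_add_two, map_sub, map_mul, aeval_X, map_ofNat, sub_mulVec, sub_mul,
    mulVec_mulVec]
  rw [two_smul, ← add_mulVec, ← two_mul]

lemma aeval_pathPoly_mulVec (j : ℕ) (hj : j < k + 2) :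
    aeval (weightedPath (k + 2)) (pathPoly j) *ᵥ Pi.single 0 1 = Pi.single ⟨j, hj⟩ 1 := by
  induction j using Nat.twoStepInduction with
  | zero =>
    rw [pathPoly_zero, map_one, one_mulVec]
    rfl
  | one =>
    simp only [pathPoly_one, map_sub, aeval_X, map_one, sub_mulVec, one_mulVec,
      weightedPath_mulVec_zero, add_sub_cancel_left]
    rfl
  | more j ih₁ ih₂ =>
    rw [aeval_weightedPath_mulVec_recurrence, ih₁ (by omega), ih₂ (by omega),
      weightedPath_mulVec_of_lt j hj]
    abel

lemma aeval_pathSum_mulVec :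
    aeval (weightedPath (k + 2)) (pathSum (k + 2)) *ᵥ Pi.single 0 1 = fun _ => 1 := by
  rw [pathSum, map_sum, sum_mulVec, Finset.sum_range]
  simp_rw [fun j : Fin (k + 2) => aeval_pathPoly_mulVec (j : ℕ) j.2]
  ext1 a
  simp [Finset.sum_apply, Pi.single_apply]

/-- One step of the recurrence beyond the last vertex: the entry `1 + X` there, in place of the
interior `2`, leaves the multiple of `X`. -/
lemma aeval_pathCharPoly_mulVec_single_zero :
    aeval (weightedPath (k + 2)) (pathCharPoly (k + 1)) *ᵥ Pi.single 0 1 =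
      (X : ℤ[X]) • Pi.single ⟨k + 1, by omega⟩ 1 := by
  rw [pathCharPoly, map_add, add_mulVec, aeval_weightedPath_mulVec_recurrence,
    aeval_pathPoly_mulVec k (by omega), aeval_pathPoly_mulVec (k + 1) (by omega),
    weightedPath_mulVec_last, add_smul, one_smul]
  abel

/-- The vector `e₀` is cyclic and polynomials in one matrix commute, so it suffices to compare both
sides at `e₀`. -/
lemma aeval_pathCharPoly :
    aeval (weightedPath (k + 2)) (pathCharPoly (k + 1)) =
      (X : ℤ[X]) • aeval (weightedPath (k + 2)) (pathPoly (k + 1)) := by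
  refine ext_of_mulVec_single fun j => ?_
  have h := aeval_pathPoly_mulVec (k := k) j j.2
  rw [← h, mulVec_mulVec, ← map_mul, mul_comm, map_mul, ← mulVec_mulVec,
    aeval_pathCharPoly_mulVec_single_zero, ← aeval_pathPoly_mulVec (k + 1) (by omega),
    smul_mulVec, mulVec_smul, mulVec_mulVec, mulVec_mulVec, ← map_mul, ← map_mul, mul_comm]

lemma isUnit_det_aeval_pathPoly :
    IsUnit (aeval (weightedPath (k + 2)) (pathPoly (k + 1))).det := by
  obtain ⟨a, b, h⟩ := isCoprime_pathCharPoly (k + 1)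
  rw [← isUnit_iff_isUnit_det]
  have h' := congrArg (aeval (weightedPath (k + 2))) h
  rw [map_add, map_mul, map_mul, aeval_pathCharPoly, map_one, mul_smul_comm, ← smul_mul_assoc,
    ← add_mul] at h'
  exact IsUnit.of_mul_eq_one_right _ h'

lemma natDegree_weightedPath_apply_le (i j : Fin (k + 2)) :
    (weightedPath (k + 2) i j).natDegree ≤ if i = Fin.last (k + 1) then 1 else 0 := by
  simp only [weightedPath, of_apply, Fin.ext_iff, Fin.val_last]
  split_ifs <;> first | omega | (compute_degree; try omega)

/-- Over `ℂ` the polynomial splits into linear factors. Each contributes degree at most one to the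
determinant, as `X` occurs only in the last row of the matrix. -/
lemma natDegree_det_aeval_weightedPath_le (p : ℂ[X]) :
    (aeval ((weightedPath (k + 2)).map (mapRingHom (Int.castRingHom ℂ))) p).det.natDegree
      ≤ p.natDegree := by
  set A := (weightedPath (k + 2)).map (mapRingHom (Int.castRingHom ℂ)) with hA
  induction h : p.natDegree generalizing p with
  | zero =>
    rw [natDegree_eq_zero] at h
    obtain ⟨c, rfl⟩ := h
    rw [aeval_C, algebraMap_eq_diagonal, det_diagonal]
    refine (natDegree_prod_le _ _).trans ?_
    simp
  | succ d ih =>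
    have hp : p.degree ≠ 0 := fun h' => by simp [natDegree_eq_of_degree_eq_some h'] at h
    obtain ⟨c, hc⟩ := IsAlgClosed.exists_root p hp
    obtain ⟨r, rfl⟩ := dvd_iff_isRoot.2 hc
    have hr : r ≠ 0 := by rintro rfl; simp at h
    rw [natDegree_mul (X_sub_C_ne_zero c) hr, natDegree_X_sub_C] at h
    rw [map_mul, det_mul]
    refine (natDegree_mul_le_of_le (m := 1) ?_ (ih r (by omega))).trans (by omega)
    refine (natDegree_det_le_sum (d := fun i => if i = Fin.last (k + 1) then 1 else 0)
      fun i j => ?_).trans (by simp)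
    rw [map_sub, aeval_X, aeval_C, algebraMap_eq_diagonal, Matrix.sub_apply, diagonal_apply]
    refine (natDegree_sub_le_of_le
      (natDegree_map_le.trans (natDegree_weightedPath_apply_le i j)) (n := 0) ?_).trans (by simp)
    split_ifs <;> simp

lemma natDegree_det_aeval_weightedPath_le_int (p : ℤ[X]) :
    (aeval (weightedPath (k + 2)) p).det.natDegree ≤ p.natDegree := by
  have hinj : Function.Injective (Int.castRingHom ℂ) := Int.cast_injective
  rw [← natDegree_map_eq_of_injective hinj, ← natDegree_map_eq_of_injective hinj p]
  refine le_trans (le_of_eq ?_) (natDegree_det_aeval_weightedPath_le (k := k) _)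
  rw [← coe_mapRingHom, RingHom.map_det, ← RingHom.mapMatrix_apply, coe_mapRingHom]
  congr 2
  change _ = aeval _ (p.map (algebraMap ℤ ℂ))
  rw [aeval_map_algebraMap]
  exact (aeval_algHom_apply (mapAlgHom (Algebra.ofId ℤ ℂ)).mapMatrix _ p).symm

/-- The determinant of `pathSum` at the weighted path is a power of the weight, up to sign. -/
lemma associated_det_aeval_pathSum :
    Associated (aeval (weightedPath (k + 2)) (pathSum (k + 2))).det (X ^ (k + 1)) := by
  set N := weightedPath (k + 2)
  have hu : IsUnit ((aeval N (pathPoly (k + 1))).det ^ 2) := isUnit_det_aeval_pathPoly.pow 2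
  have hmul : (aeval N (pathSum (k + 2))).det * (aeval N (pathCofactor (k + 2))).det =
      X ^ (2 * (k + 2)) * (aeval N (pathPoly (k + 1))).det ^ 2 := by
    rw [← det_mul, ← map_mul, pathSum_mul_pathCofactor, map_pow, aeval_pathCharPoly, det_pow,
      det_smul, Fintype.card_fin]
    ring
  have hass := associated_mul_unit_right (X ^ (2 * (k + 2)) : ℤ[X]) _ hu
  rw [← hmul] at hass
  have h₁ : (aeval N (pathSum (k + 2))).det.natDegree ≤ k + 1 :=
    (natDegree_det_aeval_weightedPath_le_int _).trans
    (natDegree_pathSum_le (k + 1))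
  have h₂ : (aeval N (pathCofactor (k + 2))).det.natDegree ≤ k + 3 :=
    (natDegree_det_aeval_weightedPath_le_int _).trans
    (natDegree_pathCofactor_le (k + 1))
  have hne : (aeval N (pathSum (k + 2))).det * (aeval N (pathCofactor (k + 2))).det ≠ 0 :=
    hass.ne_zero_iff.1 (pow_ne_zero _ X_ne_zero)
  -- The bounds `k + 1` and `k + 3` add up to exactly `2 * (k + 2)`, so both are attained.
  have hdeg := natDegree_eq_of_degree_eq (degree_eq_degree_of_associated hass)
  rw [natDegree_X_pow, natDegree_mul (left_ne_zero_of_mul hne) (right_ne_zero_of_mul hne)] at hdeg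
  obtain ⟨i, -, hi⟩ := (dvd_prime_pow prime_X _).1 ((dvd_mul_right _ _).trans hass.symm.dvd)
  have hi' := natDegree_eq_of_degree_eq (degree_eq_degree_of_associated hi)
  rw [natDegree_X_pow] at hi'
  rwa [show i = k + 1 by omega] at hi

end

/-! ### Block matrices and factorization of their walk matrices -/

section

variable {V R : Type*} [Fintype V] [DecidableEq V] [CommRing R] {k n : ℕ}

/-- The block matrix obtained from a matrix of polynomials by evaluating its entries at `M`. -/
noncomputable def blockHom (m : ℕ) (M : Matrix V V R) :
    Matrix (Fin m) (Fin m) ℤ[X] →+* Matrix (Fin m × V) (Fin m × V) R :=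
  (compRingEquiv (Fin m) V R).toRingHom.comp (aeval M).toRingHom.mapMatrix

lemma det_blockHom {m : ℕ} (M : Matrix V V R) (A : Matrix (Fin m) (Fin m) ℤ[X]) :
    (blockHom m M A).det = (aeval M A.det).det :=
  (Matrix.det_det (f := (aeval M).toRingHom) (M := A)).symm

/-- The vector obtained from a vector of polynomials by applying the values of its entries at `M`
to the vector `v`. -/
noncomputable def blockVec (m : ℕ) (M : Matrix V V R) (v : V → R) :
    (Fin m → ℤ[X]) →+ (Fin m × V → R) :=
  AddMonoidHom.mk' (fun y x => (aeval M (y x.1) *ᵥ v) x.2) fun y z => by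
    ext x; simp [add_mulVec]

lemma blockVec_apply {m : ℕ} (M : Matrix V V R) (v : V → R) (y : Fin m → ℤ[X]) (x : Fin m × V) :
    blockVec m M v y x = (aeval M (y x.1) *ᵥ v) x.2 := rfl

lemma blockHom_mulVec_blockVec {m : ℕ} (M : Matrix V V R) (v : V → R)
    (A : Matrix (Fin m) (Fin m) ℤ[X]) (y : Fin m → ℤ[X]) :
    blockHom m M A *ᵥ blockVec m M v y = blockVec m M v (A *ᵥ y) := by
  ext ⟨a, b⟩
  have h : ((aeval M (∑ i, A a i * y i)) *ᵥ v) b = ∑ i, (aeval M (A a i * y i) *ᵥ v) b := by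
    rw [map_sum, sum_mulVec, Finset.sum_apply]
  refine (Fintype.sum_prod_type _).trans (Eq.trans ?_ h.symm)
  refine Finset.sum_congr rfl fun i _ => ?_
  rw [map_mul, ← mulVec_mulVec]
  rfl

/-- The walk matrix of `M` and `v`, with columns enumerated by `τ`. -/
def walkMatrix (M : Matrix V V R) (v : V → R) (τ : V ≃ Fin n) : Matrix V V R :=
  Matrix.of fun b w => (M ^ (τ w : ℕ) *ᵥ v) b

/-- The walk matrix of the weighted path with weight `M`, for the vector represented by `y`. -/
noncomputable def blockWalkMatrix {m : ℕ} (M : Matrix V V R) (v : V → R)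
    (num : Fin m × V ≃ Fin (n * m)) (y : Fin m → ℤ[X]) : Matrix (Fin m × V) (Fin m × V) R :=
  Matrix.of fun x c => blockVec m M v (weightedPath m ^ (num c : ℕ) *ᵥ y) x

lemma blockWalkMatrix_aeval_mulVec {m : ℕ} (M : Matrix V V R) (v : V → R)
    (num : Fin m × V ≃ Fin (n * m)) (p : ℤ[X]) (y : Fin m → ℤ[X]) :
    blockWalkMatrix M v num (aeval (weightedPath m) p *ᵥ y) =
      blockHom m M (aeval (weightedPath m) p) * blockWalkMatrix M v num y := by
  ext x c
  have h : weightedPath m ^ (num c : ℕ) * aeval (weightedPath m) p =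
      aeval (weightedPath m) p * weightedPath m ^ (num c : ℕ) := by
    rw [← aeval_X_pow (R := ℤ) (weightedPath m), ← map_mul, ← map_mul, mul_comm]
  simp only [blockWalkMatrix, of_apply]
  rw [mulVec_mulVec, h, ← mulVec_mulVec, ← blockHom_mulVec_blockVec]
  rfl

/-- A basis of the polynomials of degree less than `n * (k + 2)`. -/
noncomputable def pathBasis (k n : ℕ) (i j : ℕ) : ℤ[X] :=
  pathCharPoly (k + 1) ^ i * pathPoly (k + 1) ^ (n - 1 - i) * pathPoly j

lemma natDegree_pathBasis_lt {i j : ℕ} (hi : i < n) (hj : j < k + 2) :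
    (pathBasis k n i j).natDegree < n * (k + 2) := by
  have h₁ : (pathCharPoly (k + 1) ^ i).natDegree ≤ i * (k + 2) :=
    natDegree_pow_le_of_le i (natDegree_pathCharPoly_le _)
  have h₂ : (pathPoly (k + 1) ^ (n - 1 - i)).natDegree ≤ (n - 1 - i) * (k + 1) :=
    natDegree_pow_le_of_le _ (natDegree_pathPoly_le _)
  refine (natDegree_mul_le_of_le (natDegree_mul_le_of_le h₁ h₂)
    (natDegree_pathPoly_le j)).trans_lt ?_
  obtain ⟨d, rfl⟩ : ∃ d, n = i + d + 1 := ⟨n - 1 - i, by omega⟩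
  rw [show i + d + 1 - 1 - i = d by omega]
  nlinarith

/-- Each `pathCharPoly` contributes `X` and one `pathPoly (k + 1)`; the exponent `n - 1 - i` makes
the total power of the latter independent of `i`. -/
lemma aeval_pathBasis_mulVec {i j : ℕ} (hi : i < n) (hj : j < k + 2) :
    aeval (weightedPath (k + 2)) (pathBasis k n i j) *ᵥ Pi.single 0 1 =
      aeval (weightedPath (k + 2)) (pathPoly (k + 1) ^ (n - 1)) *ᵥ
        (X ^ i : ℤ[X]) • Pi.single ⟨j, hj⟩ 1 := by
  rw [pathBasis, map_mul, ← mulVec_mulVec, aeval_pathPoly_mulVec j hj, map_mul, map_pow,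
    aeval_pathCharPoly, _root_.smul_pow, ← map_pow, smul_mul_assoc, ← map_mul, ← pow_add,
    show i + (n - 1 - i) = n - 1 by omega, smul_mulVec, mulVec_smul]

/-- The coefficients of the polynomials `pathBasis`. -/
noncomputable def pathBasisMatrix (τ : V ≃ Fin n) (num : Fin (k + 2) × V ≃ Fin (n * (k + 2))) :
    Matrix (Fin (k + 2) × V) (Fin (k + 2) × V) ℤ :=
  Matrix.of fun c x => (pathBasis k n (τ x.2) x.1).coeff (num c)

lemma blockWalkMatrix_mul_pathBasisMatrix (M : Matrix V V R) (v : V → R) (τ : V ≃ Fin n)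
    (num : Fin (k + 2) × V ≃ Fin (n * (k + 2))) :
    blockWalkMatrix M v num (Pi.single 0 1) * (pathBasisMatrix τ num).map (Int.castRingHom R) =
      blockHom (k + 2) M (aeval (weightedPath (k + 2)) (pathPoly (k + 1) ^ (n - 1))) *
        ((1 : Matrix (Fin (k + 2)) (Fin (k + 2)) R) ⊗ₖ walkMatrix M v τ) := by
  ext x ⟨j, w⟩
  have hsum := aeval_eq_sum_range' (natDegree_pathBasis_lt (k := k) (τ w).2 j.2)
    (weightedPath (k + 2))
  rw [Finset.sum_range, ← Equiv.sum_comp num] at hsum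
  have h₁ : (blockWalkMatrix M v num (Pi.single 0 1) *
      (pathBasisMatrix τ num).map (Int.castRingHom R)) x (j, w) =
      blockVec (k + 2) M v (aeval (weightedPath (k + 2)) (pathBasis k n (τ w) j) *ᵥ
        Pi.single 0 1) x := by
    rw [hsum, sum_mulVec, map_sum, Finset.sum_apply, Matrix.mul_apply]
    refine Finset.sum_congr rfl fun c _ => ?_
    rw [smul_mulVec, map_zsmul, Pi.smul_apply, zsmul_eq_mul, mul_comm]
    rfl
  rw [h₁, aeval_pathBasis_mulVec (τ w).2 j.2, ← blockHom_mulVec_blockVec, Matrix.mul_apply,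
    mulVec, dotProduct]
  refine Finset.sum_congr rfl fun y _ => ?_
  congr 1
  rw [blockVec_apply, kroneckerMap_apply, one_apply, Pi.smul_apply, Pi.single_apply]
  split_ifs with h
  · simp [walkMatrix]
  · simp

lemma sq_det_aeval_of_isUnit (M : Matrix V V R) {p : ℤ[X]} (hp : IsUnit p) :
    (aeval M p).det ^ 2 = 1 := by
  obtain ⟨r, hr, rfl⟩ := Polynomial.isUnit_iff.1 hp
  rw [← det_pow, ← map_pow, ← C_pow, Int.isUnit_sq hr, C_1, map_one, det_one]

lemma sq_det_blockWalkMatrix_mul (M : Matrix V V R) (v : V → R) (τ : V ≃ Fin n)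
    (num : Fin (k + 2) × V ≃ Fin (n * (k + 2))) :
    (blockWalkMatrix M v num (Pi.single 0 1)).det ^ 2 *
        (((pathBasisMatrix τ num).det ^ 2 : ℤ) : R) = ((walkMatrix M v τ).det ^ (k + 2)) ^ 2 := by
  have h := congrArg (fun A => A.det ^ 2) (blockWalkMatrix_mul_pathBasisMatrix M v τ num)
  simp only [det_mul, det_kronecker, det_one, one_pow, one_mul, Fintype.card_fin, mul_pow,
    ← RingHom.mapMatrix_apply, ← RingHom.map_det] at h
  rw [det_blockHom, sq_det_aeval_of_isUnit, one_mul] at h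
  · rw [← h]; simp
  · rw [map_pow, det_pow]
    exact isUnit_det_aeval_pathPoly.pow _

/-- A nilpotent shift moves the first basis vector through all the others. -/
lemma exists_walkMatrix_eq_one (τ : V ≃ Fin n) :
    ∃ (M : Matrix V V ℤ) (v : V → ℤ), walkMatrix M v τ = 1 := by
  refine ⟨Matrix.of fun i j => if (τ i : ℕ) = τ j + 1 then 1 else 0,
    fun i => if (τ i : ℕ) = 0 then 1 else 0, ?_⟩
  have h : ∀ l < n, ((Matrix.of fun i j => if (τ i : ℕ) = τ j + 1 then 1 else 0 :
      Matrix V V ℤ) ^ l *ᵥ fun i => if (τ i : ℕ) = 0 then 1 else 0) =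
      fun i => if (τ i : ℕ) = l then 1 else 0 := by
    intro l hl
    induction l with
    | zero => simp
    | succ l ih =>
      rw [pow_succ', ← mulVec_mulVec, ih (by omega)]
      ext i
      simp only [mulVec, dotProduct, of_apply]
      rw [Finset.sum_eq_single (τ.symm ⟨l, by omega⟩)]
      · simp
      · intro j _ hj
        rw [if_neg (c := (τ j : ℕ) = l), mul_zero]
        exact fun h => hj (τ.eq_symm_apply.2 (Fin.ext h))
      · simp
  ext i j
  rw [walkMatrix, of_apply, h _ (τ j).2, one_apply]
  simp [Fin.val_inj]

/-- This matrix does not depend on `M` or `v`, so one integral example with walk determinant `1`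
shows that its determinant divides `1`. -/
lemma sq_det_pathBasisMatrix (τ : V ≃ Fin n) (num : Fin (k + 2) × V ≃ Fin (n * (k + 2))) :
    (pathBasisMatrix τ num).det ^ 2 = 1 := by
  obtain ⟨M, v, h⟩ := exists_walkMatrix_eq_one τ
  have h' := sq_det_blockWalkMatrix_mul M v τ num
  rw [h, det_one, one_pow, one_pow, Int.cast_id] at h'
  exact Int.isUnit_sq ((isUnit_pow_iff two_ne_zero).1 (IsUnit.of_mul_eq_one_right _ h'))

lemma sq_det_blockWalkMatrix (M : Matrix V V R) (v : V → R) (τ : V ≃ Fin n)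
    (num : Fin (k + 2) × V ≃ Fin (n * (k + 2))) :
    (blockWalkMatrix M v num fun _ => 1).det ^ 2 =
      (M.det ^ (k + 1) * (walkMatrix M v τ).det ^ (k + 2)) ^ 2 := by
  have h := sq_det_blockWalkMatrix_mul M v τ num
  rw [sq_det_pathBasisMatrix, Int.cast_one, mul_one] at h
  obtain ⟨u, hu⟩ := (associated_det_aeval_pathSum (k := k)).symm
  rw [← aeval_pathSum_mulVec, blockWalkMatrix_aeval_mulVec, det_mul, det_blockHom, mul_pow, h, ← hu,
    map_mul, det_mul, mul_pow, sq_det_aeval_of_isUnit M u.isUnit, aeval_X_pow, det_pow]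
  ring

end

/-! ### The signless Laplacian of the rooted product as a block matrix -/

section

variable {V : Type*} [Fintype V]

open Classical in
lemma SimpleGraph.signlessLapMatrix_apply (G : SimpleGraph V) (x y : V) :
    G.signlessLapMatrix x y = (if G.Adj x y then 1 else 0) +
      if x = y then ∑ z, (if G.Adj x z then 1 else 0) else 0 := by
  rw [SimpleGraph.signlessLapMatrix, Matrix.add_apply, SimpleGraph.adjMatrix_apply,
    SimpleGraph.degMatrix, diagonal_apply, Finset.sum_boole, ← G.neighborFinset_eq_filter]
  rfl

lemma sum_path_adj {m : ℕ} (a : Fin m) :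
    ∑ c : Fin m, (if (a : ℕ) + 1 = c ∨ (c : ℕ) + 1 = a then (1 : ℝ) else 0) =
      (if 0 < (a : ℕ) then 1 else 0) + if (a : ℕ) + 1 < m then 1 else 0 := by
  have h : ∀ c : Fin m, (if (a : ℕ) + 1 = c ∨ (c : ℕ) + 1 = a then (1 : ℝ) else 0) =
      (if (c : ℕ) + 1 = a then 1 else 0) + if (a : ℕ) + 1 = c then 1 else 0 := by
    intro c
    split_ifs <;> first | omega | simp
  rw [Finset.sum_congr rfl fun c _ => h c, Finset.sum_add_distrib]
  congr 1
  · split_ifs with h0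
    · rw [Finset.sum_eq_single ⟨a - 1, by omega⟩]
      · rw [if_pos]; exact Nat.sub_add_cancel h0
      · exact fun b _ hb => if_neg fun h => hb (Fin.ext (by simp; omega))
      · simp
    · exact Finset.sum_eq_zero fun c _ => if_neg (by omega)
  · split_ifs with h0
    · rw [Finset.sum_eq_single ⟨a + 1, h0⟩]
      · rw [if_pos rfl]
      · exact fun b _ hb => if_neg fun h => hb (Fin.ext h.symm)
      · simp
    · exact Finset.sum_eq_zero fun c _ => if_neg (by omega)

variable [DecidableEq V]

lemma aeval_weightedPath_apply {R : Type*} [CommRing R] {m : ℕ} (M : Matrix V V R) (a b : Fin m)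
    (i j : V) :
    aeval M (weightedPath m a b) i j =
      (if i = j ∧ ((a : ℕ) + 1 = b ∨ (b : ℕ) + 1 = a) then 1 else 0) +
        (if a = b ∧ i = j then
          (if 0 < (a : ℕ) then 1 else 0) + (if (a : ℕ) + 1 < m then 1 else 0) else 0) +
        if a = b ∧ (a : ℕ) + 1 = m then M i j else 0 := by
  have h : ∀ (p : Prop) [Decidable p] (f : ℤ[X]),
      aeval M (if p then f else 0) = if p then aeval M f else 0 := by
    intro p _ f; split_ifs <;> simp
  simp only [weightedPath, of_apply, map_add, h, map_one, aeval_X, Matrix.add_apply]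
  by_cases h₁ : a = b <;> by_cases h₂ : i = j <;> by_cases h₃ : (a : ℕ) + 1 = m <;>
    simp only [h₁, h₂, h₃, true_and, false_and, and_true, and_false, if_true, if_false] <;>
    split_ifs <;> simp_all

open Classical in
lemma signlessLapMatrix_rootedProduct_apply (G : SimpleGraph V) {m : ℕ} (r : Fin m)
    (φ : Fin m ≃ Fin m) (hr : ∀ a, φ a = r ↔ (a : ℕ) + 1 = m)
    (hφ : ∀ a b, (SimpleGraph.pathGraph m).Adj (φ a) (φ b) ↔ (a : ℕ) + 1 = b ∨ (b : ℕ) + 1 = a)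
    (a b : Fin m) (i j : V) :
    (G.rootedProduct (SimpleGraph.pathGraph m) r).signlessLapMatrix (i, φ a) (j, φ b) =
      aeval G.signlessLapMatrix (weightedPath m a b) i j := by
  have hadj : ∀ c l, (if (G.rootedProduct (SimpleGraph.pathGraph m) r).Adj (i, φ a) (l, φ c)
        then (1 : ℝ) else 0) =
      (if i = l ∧ ((a : ℕ) + 1 = c ∨ (c : ℕ) + 1 = a) then 1 else 0) +
        if a = c ∧ (a : ℕ) + 1 = m ∧ G.Adj i l then 1 else 0 := by
    intro c l
    have hlast : ((a : ℕ) + 1 = m ∧ (c : ℕ) + 1 = m ∧ G.Adj i l) ↔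
        (a = c ∧ (a : ℕ) + 1 = m ∧ G.Adj i l) := by
      rw [Fin.ext_iff]
      constructor <;> rintro ⟨h₁, h₂, h₃⟩ <;> exact ⟨by omega, by omega, h₃⟩
    simp only [SimpleGraph.rootedProduct, hφ, hr, hlast]
    by_cases h : i = l
    · subst h; simp
    · simp [h]
  have hsum : ∑ z, (if (G.rootedProduct (SimpleGraph.pathGraph m) r).Adj (i, φ a) z
        then (1 : ℝ) else 0) =
      (if 0 < (a : ℕ) then 1 else 0) + (if (a : ℕ) + 1 < m then 1 else 0) +
        if (a : ℕ) + 1 = m then ∑ l, (if G.Adj i l then 1 else 0) else 0 := by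
    rw [Fintype.sum_prod_type]
    simp_rw [fun l => (Equiv.sum_comp φ fun c =>
      if (G.rootedProduct (SimpleGraph.pathGraph m) r).Adj (i, φ a) (l, c)
        then (1 : ℝ) else 0).symm, hadj, Finset.sum_add_distrib, ite_and]
    congr 1
    · simp [← sum_path_adj]
    · simp
  rw [SimpleGraph.signlessLapMatrix_apply, hadj, hsum, aeval_weightedPath_apply,
    SimpleGraph.signlessLapMatrix_apply]
  simp only [Prod.mk.injEq, φ.injective.eq_iff]
  by_cases h₁ : a = b <;> by_cases h₂ : i = j <;> by_cases h₃ : (a : ℕ) + 1 = m <;>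
    simp only [h₁, h₂, h₃, true_and, false_and, and_true, and_false, if_true, if_false] <;>
    (simp_all; try ring)

lemma submatrix_pow_mulVec {R ι κ : Type*} [CommRing R] [Fintype ι] [Fintype κ] [DecidableEq ι]
    [DecidableEq κ] (A : Matrix κ κ R) (e : ι ≃ κ) (u : κ → R) (l : ℕ) :
    A.submatrix e e ^ l *ᵥ (u ∘ e) = (A ^ l *ᵥ u) ∘ e := by
  induction l with
  | zero => simp
  | succ l ih =>
    rw [pow_succ', pow_succ', ← mulVec_mulVec, ih, ← mulVec_mulVec, submatrix_mulVec_equiv]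
    simp [Function.comp_assoc]

/-- Rows and columns are reindexed by the same bijection, so no sign appears. -/
lemma det_qWalkMatrix_eq (G : SimpleGraph V) {n : ℕ} (σ : Fin n ≃ V) :
    (G.qWalkMatrix σ).det = (walkMatrix G.signlessLapMatrix (fun _ => 1) σ.symm).det := by
  rw [← det_submatrix_equiv_self σ.symm]
  congr 1
  ext i j
  simp only [SimpleGraph.qWalkMatrix, walkMatrix, submatrix_apply, of_apply,
    Equiv.apply_symm_apply]
  congr!

lemma det_qWalkMatrix_rootedProduct_eq (G : SimpleGraph V) {m n : ℕ} (r : Fin m)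
    (φ : Fin m ≃ Fin m) (hr : ∀ a, φ a = r ↔ (a : ℕ) + 1 = m)
    (hφ : ∀ a b, (SimpleGraph.pathGraph m).Adj (φ a) (φ b) ↔ (a : ℕ) + 1 = b ∨ (b : ℕ) + 1 = a)
    (ρ : Fin (n * m) ≃ V × Fin m) :
    ((G.rootedProduct (SimpleGraph.pathGraph m) r).qWalkMatrix ρ).det =
      (blockWalkMatrix G.signlessLapMatrix (fun _ => 1)
        (((Equiv.prodComm _ _).trans ((Equiv.refl V).prodCongr φ)).trans ρ.symm)
        fun _ => 1).det := by
  set e : Fin m × V ≃ V × Fin m := (Equiv.prodComm _ _).trans ((Equiv.refl V).prodCongr φ)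
  set Q := (G.rootedProduct (SimpleGraph.pathGraph m) r).signlessLapMatrix with hQ
  have hblock : blockHom m G.signlessLapMatrix (weightedPath m) = Q.submatrix e e := by
    ext ⟨a, i⟩ ⟨b, j⟩
    exact (signlessLapMatrix_rootedProduct_apply G r φ hr hφ a b i j).symm
  have hone : blockVec m G.signlessLapMatrix (fun _ => 1) (fun _ => 1) = (fun _ => 1) ∘ e := by
    ext x
    simp [blockVec_apply]
  rw [det_qWalkMatrix_eq, ← det_submatrix_equiv_self e]
  congr 1
  ext x c
  rw [blockWalkMatrix, of_apply, ← blockHom_mulVec_blockVec, map_pow, hblock, hone,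
    submatrix_pow_mulVec]
  rfl

end

/-- The determinant of the `Q`-walk matrix of the rooted product of a graph with a path. -/
theorem mainTheorem1 {V : Type*} [Fintype V] [DecidableEq V] (G : SimpleGraph V)
    (n : ℕ) (σ : Fin n ≃ V)
    (m : ℕ) (hm : 2 ≤ m)
    (r : Fin m) (hr : (r : ℕ) = 0 ∨ (r : ℕ) + 1 = m)
    (ρ : Fin (n * m) ≃ V × Fin m) :
    ((G.rootedProduct (SimpleGraph.pathGraph m) r).qWalkMatrix ρ).det =
        G.signlessLapMatrix.det ^ (m - 1) * (G.qWalkMatrix σ).det ^ m ∨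
      ((G.rootedProduct (SimpleGraph.pathGraph m) r).qWalkMatrix ρ).det =
        -(G.signlessLapMatrix.det ^ (m - 1) * (G.qWalkMatrix σ).det ^ m) := by
  obtain ⟨φ, hφr, hφ⟩ : ∃ φ : Fin m ≃ Fin m, (∀ a, φ a = r ↔ (a : ℕ) + 1 = m) ∧
      ∀ a b, (SimpleGraph.pathGraph m).Adj (φ a) (φ b) ↔
        (a : ℕ) + 1 = b ∨ (b : ℕ) + 1 = a := by
    rcases hr with hr | hr
    -- Reversal moves a root at position `0` to the last position, where `weightedPath` carries `X`.
    · refine ⟨Fin.revPerm, fun a => ?_, fun a b => ?_⟩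
      · rw [Fin.ext_iff, hr, Fin.revPerm_apply, Fin.val_rev]
        omega
      · rw [SimpleGraph.pathGraph_adj, Fin.revPerm_apply, Fin.revPerm_apply, Fin.val_rev,
          Fin.val_rev]
        omega
    · refine ⟨Equiv.refl _, fun a => ?_, fun a b => SimpleGraph.pathGraph_adj⟩
      rw [Fin.ext_iff, Equiv.refl_apply]
      omega
  obtain ⟨k, rfl⟩ := Nat.exists_eq_add_of_le' hm
  rw [← sq_eq_sq_iff_eq_or_eq_neg, det_qWalkMatrix_rootedProduct_eq G r φ hφr hφ ρ,
    sq_det_blockWalkMatrix _ _ σ.symm, ← det_qWalkMatrix_eq]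
  rfl
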